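/- Definitions. Let $F$ be a finite field. An $(n,N,k,m)$ multiset batch code over $F$ is an encoding $C:F^n\to F^N$ together with a partition of the $N$ code symbols into $m$ nonempty buckets such that, for every sequence $i_1,\dots,i_k\in\{1,\dots,n\}$ (repetitions allowed), there are sets $R_1,\dots,R_k$ of code symbols with the following properties: for all messages $x$, the symbol $x_{i_a}$ is a function of the code symbols of $C(x)$ in $R_a$; for $a\neq a'$ the sets of buckets met by $R_a$ and $R_{a'}$ are disjoint; and each bucket contains at most one symbol of $R_1\cup\dots\cup R_k$. Its rate is $n/N$. A generalized quadrangle of order $(s,t)$, $s,t\ge 1$, is a nonempty set $P$ of points with a set $\mathcal L$ of subsets of $P$ (lines) such that every point is on exactly $t+1$ lines, every line has exactly $s+1$ points, two distinct points are on at most one common line, two distinct lines share at most one point, and for every point $x$ and line $L\not\ni x$ there is a unique pair $(y,M)$ with $M\in\mathcal L$, $x,y\in M$, $y\in L$. Given $E\in F^{\mathcal L\times P}$ with $E_{L,p}\ne 0$ if and only if $p\in L$, let $C_E:F^{\mathcal L}\to F^{\mathcal L\sqcup P}$ be the systematic linear code $C_E(x)=\bigl(x,\,(\sum_{L}x_LE_{L,p})_{p\in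 P}\bigr)$, whose bipartite graph (message symbols versus parity symbols) is the incidence graph of $(P,\mathcal L)$. Fix an enumeration of $\mathcal L$. For $g\in\mathbb N$, the code $g\cdot C_E$ on messages of length $n$ cuts the message into $g$ consecutive blocks of length $|\mathcal L|$ (padding with zeros at the end), encodes each block by $C_E$, and for each $v\in\mathcal L\sqcup P$ puts the $g$ symbols at position $v$ of the $g$ codewords into one bucket. Theorem. (1) For every prime power $q$ and every field $K$ with $q^2$ elements, the points of the Hermitian variety $\sum_{i=0}^{4}v_i^{q+1}=0$ in the projective space $PG(4,K)$, with the lines of $PG(4,K)$ contained in this variety, form a generalized quadrangle of order $(q^2,q^3)$. (2) There is a function $m:\mathbb N\to\mathbb N$ with $m(k)=(1+o(1))k^4$ as $k\to\infty$ such that for every prime power $q$, with $k=q^2$, there is $n_0$ such that for all $n\ge n_0$, with $g=\lceil n/k^4\rceil$ and $N=g\,m(k)$, one has $n/N\ge 1-1/\sqrt k$, and for every generalized quadrangle $(P,\mathcal L)$ of order $(q^2,q^3)$, every finite field $F$, every matrix $E$ as above and every enumeration of $\mathcal L$, the code $g\cdot C_E$ on messages of length $n$ is an $(n,N,k,m(k))$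 multiset batch code over $F$. In particular, for every prime power $q$, $k=q^2$ and all large $n$ there is an explicit $(n,N,k,m)$ multiset batch code of rate at least $1-1/\sqrt k$, with $m=(1+o(1))k^4$ and $N=\lceil n/k^4\rceil m$. -/

import Mathlib

open Filter Topology
open scoped LinearAlgebra.Projectivization

/-- An `(n, N, k, m, t)` multiset batch code over the alphabet `F`: an encoder `C` of `n` message
symbols into `N` code symbols (indexed by `J`), with the code symbols partitioned into `m` buckets
(indexed by `B`) by the map `bucket`. Every sequence `r` of `k` read requests, with repetitions
allowed, can be served: request `a` reads the code symbols in `R a`, which determine the requested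
message symbol; different requests use disjoint sets of buckets; at most `t` symbols in all are
read from any bucket. -/
structure IsMultisetBatchCode {F J B : Type*} [Fintype J] [Fintype B] (n N k m t : ℕ)
    (C : (Fin n → F) → J → F) (bucket : J → B) : Prop where
  card_symbols : Fintype.card J = N
  card_buckets : Fintype.card B = m
  bucket_nonempty : Function.Surjective bucket
  serve : ∀ r : Fin k → Fin n, ∃ R : Fin k → Set J,
    (∀ a, ∃ decode : (R a → F) → F, ∀ x : Fin n → F, decode (fun j => C x j) = x (r a)) ∧
    (∀ a a', a ≠ a' → Disjoint (bucket '' R a) (bucket '' R a')) ∧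
    (∀ b, {j | bucket j = b ∧ ∃ a, j ∈ R a}.ncard ≤ t)

/-- The systematic linear code with generator matrix `[I | E]`: message symbols are indexed by `L`,
parity symbols by `P`. Its bipartite graph joins `l : L` to `p : P` iff `E l p ≠ 0`. -/
def systematicCode {F L P : Type*} [Field F] [Fintype L] (E : Matrix L P F) (x : L → F) :
    L ⊕ P → F :=
  Sum.elim x (Matrix.vecMul x E)

/-- The message `x₀, …, x_{n-1}` cut into consecutive blocks of length `l`, each block indexed by
`L` through the enumeration `e`; the `j`-th block (`j = 0, 1, …`), padded with zeros
beyond position `n - 1`. -/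
def messageBlock {F L : Type*} [Zero F] {n l : ℕ} (e : L ≃ Fin l) (x : Fin n → F) (j : ℕ) : L → F :=
  fun i => if h : j * l + (e i : ℕ) < n then x ⟨j * l + (e i : ℕ), h⟩ else 0

/-- `g` stacked copies of the code `C`: the `j`-th copy encodes the `j`-th block of the message.
The code symbol `(j, v)` is the symbol at position `v` of the codeword of the `j`-th block. -/
def stackedCode {F L V : Type*} [Zero F] {l : ℕ} (n g : ℕ) (e : L ≃ Fin l) (C : (L → F) → V → F)
    (x : Fin n → F) : Fin g × V → F :=
  fun jv => C (messageBlock e x jv.1) jv.2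

/-- `(P, 𝓛)` is a generalized quadrangle of order `(s, t)`: the lines `𝓛` are sets of points. -/
structure IsGeneralizedQuadrangle {P : Type*} (𝓛 : Set (Set P)) (s t : ℕ) : Prop where
  nonempty : Nonempty P
  one_le_s : 1 ≤ s
  one_le_t : 1 ≤ t
  lines_through : ∀ x : P, {M | M ∈ 𝓛 ∧ x ∈ M}.ncard = t + 1
  line_unique : ∀ x y : P, x ≠ y → ∀ M ∈ 𝓛, ∀ M' ∈ 𝓛, x ∈ M → y ∈ M → x ∈ M' → y ∈ M' → M = M'
  points_on : ∀ M ∈ 𝓛, M.ncard = s + 1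
  point_unique : ∀ M ∈ 𝓛, ∀ M' ∈ 𝓛, M ≠ M' → ∀ x y : P, x ∈ M → x ∈ M' → y ∈ M → y ∈ M' → x = y
  projection : ∀ x : P, ∀ M ∈ 𝓛, x ∉ M →
    ∃! yM : P × Set P, yM.2 ∈ 𝓛 ∧ yM.1 ∈ yM.2 ∧ x ∈ yM.2 ∧ yM.1 ∈ M

/-- The points of the Hermitian variety `∑ vᵢ ^ (q + 1) = 0` in the projective space `PG(4, K)`,
used for a field `K` with `q ^ 2` elements. -/
def HermitianPoint (q : ℕ) (K : Type*) [Field K] : Type _ :=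
  {p : ℙ K (Fin 5 → K) // ∀ v ∈ p.submodule, ∑ i, v i ^ (q + 1) = 0}

/-- The lines of `PG(4, K)` contained in the Hermitian variety, as sets of points. -/
def hermitianLines (q : ℕ) (K : Type*) [Field K] : Set (Set (HermitianPoint q K)) :=
  {M | ∃ W : Submodule K (Fin 5 → K), Module.finrank K W = 2 ∧
    (∀ v ∈ W, ∑ i, v i ^ (q + 1) = 0) ∧ M = {p | p.1.submodule ≤ W}}

/-! ### Generalized quadrangles: counting and choice of points -/

namespace IsGeneralizedQuadrangle

variable {P : Type*} {𝓛 : Set (Set P)} {s t : ℕ}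

/-! A request for the symbol at a line is served by choosing a point of that line and reading the
parity there together with the message symbols at the other lines through the point. Two such reads
are disjoint when the chosen points differ and no line other than the two requested ones joins them.
Points are chosen greedily: by the projection axiom an earlier point spoils at most one point of the
next line (`exists_obstruction`), so `s + 1` requests can be served (`exists_points`), repeated ones
included. Stacking copies keeps this: each request stays inside one copy.

For order `(q ^ 2, q ^ 3)` there are at least `q ^ 8 = k ^ 4` lines, and lines and points together
number `k ^ 4 (1 + O(1 / √k))`; this gives the number of copies, the bucket count and the rate.

For the Hermitian variety, the form is studied through its semilinear map to the dual space. Trace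
and norm fibres over the subfield of order `q` are counted exactly by pigeonhole, which gives the
number of isotropic vectors and hence of lines through a point. The projection axiom holds because
dimension five admits no totally isotropic subspace of dimension three. -/

theorem exists_line (h : IsGeneralizedQuadrangle 𝓛 s t) (x : P) : ∃ M ∈ 𝓛, x ∈ M := by
  have h1 := h.lines_through x
  have : {M | M ∈ 𝓛 ∧ x ∈ M}.Nonempty := by
    rw [Set.nonempty_iff_ne_empty]
    intro h0
    rw [h0, Set.ncard_empty] at h1
    omega
  exact this

theorem ncard_diff_singleton (h : IsGeneralizedQuadrangle 𝓛 s t) {M : Set P} (hM : M ∈ 𝓛)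
    {y : P} (hy : y ∈ M) : (M \ {y}).ncard = s := by
  rw [Set.ncard_sdiff_singleton_of_mem hy, h.points_on M hM, Nat.add_sub_cancel]

theorem ncard_other_lines (h : IsGeneralizedQuadrangle 𝓛 s t) {M : Set P} (hM : M ∈ 𝓛)
    {y : P} (hy : y ∈ M) : {N | N ∈ 𝓛 ∧ y ∈ N ∧ N ≠ M}.ncard = t := by
  have : {N | N ∈ 𝓛 ∧ y ∈ N ∧ N ≠ M} = {N | N ∈ 𝓛 ∧ y ∈ N} \ {M} := by
    ext N; simp only [Set.mem_sdiff, Set.mem_ofPred_eq, Set.mem_singleton_iff, and_assoc, ne_eq]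
  rw [this, Set.ncard_sdiff_singleton_of_mem (show M ∈ {N | N ∈ 𝓛 ∧ y ∈ N} from ⟨hM, hy⟩), h.lines_through y, Nat.add_sub_cancel]

/-- The points off a line `M` are counted by projecting them to `M`. -/
theorem ncard_compl_line [Finite P] (h : IsGeneralizedQuadrangle 𝓛 s t) {M : Set P}
    (hM : M ∈ 𝓛) : (Mᶜ).ncard = (s + 1) * t * s := by
  classical
  have := Fintype.ofFinite P
  -- Flags `(y, N)` meeting `M` in `y`. Each point off `M` projects to one flag, and the fibre over
  -- `(y, N)` is `N` without `y`.
  let D : Finset (P × Set P) :=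
    Finset.univ.filter fun yN => yN.2 ∈ 𝓛 ∧ yN.1 ∈ yN.2 ∧ yN.1 ∈ M ∧ yN.2 ≠ M
  have hD : D.card = (s + 1) * t := by
    rw [Finset.card_eq_sum_card_fiberwise (f := Prod.fst) (t := M.toFinset)
      (by intro a ha; simp [D] at ha; simpa using ha.2.2.1)]
    rw [Finset.sum_const_nat (m := t), ← Set.ncard_eq_toFinset_card', h.points_on M hM]
    intro y hy
    rw [Set.mem_toFinset] at hy
    rw [← h.ncard_other_lines hM hy, ← Set.ncard_coe_finset]
    refine Set.ncard_congr (fun a _ => a.2) ?_ ?_ ?_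
    · rintro ⟨z, N⟩ ha
      simp [D] at ha
      obtain ⟨ha, rfl⟩ := ha
      exact ⟨ha.1, ha.2.1, ha.2.2.2⟩
    · rintro ⟨z, N⟩ ⟨z', N'⟩ ha hb hN
      simp [D] at ha hb
      simp_all
    · rintro N ⟨h1, h2, h3⟩
      exact ⟨(y, N), by simp [D, h1, h2, h3, hy], rfl⟩
  choose f hf hf' using fun x : P => fun hx : x ∉ M => h.projection x M hM hx
  let F : P → P × Set P := fun x => if hx : x ∉ M then f x hx else (x, M)
  have hF : ∀ (x) (hx : x ∉ M), F x = f x hx := fun x hx => dif_pos hx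
  have hMc : (Mᶜ).ncard = (Finset.univ.filter fun x => x ∉ M).card := by
    rw [← Set.ncard_coe_finset]; congr 1; ext; simp
  have hmaps : Set.MapsTo F (Finset.univ.filter fun x => x ∉ M : Finset P) D := by
    intro x hx
    have hx : x ∉ M := by simpa using hx
    have h1 := hf x hx
    simp only [D, Finset.coe_filter, Finset.mem_univ, true_and, Set.mem_ofPred_eq, hF x hx]
    refine ⟨h1.1, h1.2.1, h1.2.2.2, ?_⟩
    intro h2
    exact hx (h2 ▸ h1.2.2.1)
  rw [hMc, Finset.card_eq_sum_card_fiberwise hmaps, Finset.sum_const_nat (m := s), hD]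
  rintro ⟨y, N⟩ hyN
  simp only [D, Finset.mem_filter, Finset.mem_univ, true_and] at hyN
  obtain ⟨hN, hyN, hyM, hNM⟩ := hyN
  rw [← h.ncard_diff_singleton hN hyN, ← Set.ncard_coe_finset]
  congr 1
  ext x
  simp only [Finset.coe_filter, Finset.mem_filter, Finset.mem_univ, true_and, Set.mem_ofPred_eq,
    Set.mem_sdiff, Set.mem_singleton_iff]
  constructor
  · rintro ⟨hx, hFx⟩
    rw [hF x hx] at hFx
    have h1 := hf x hx
    rw [hFx] at h1
    exact ⟨h1.2.2.1, fun h2 => hx (h2 ▸ hyM)⟩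
  · rintro ⟨hxN, hxy⟩
    have hx : x ∉ M := fun hxM => hxy (h.point_unique N hN M hM hNM x y hxN hxM hyN hyM)
    exact ⟨hx, by rw [hF x hx]; exact (hf' x hx (y, N) ⟨hN, hyN, hxN, hyM⟩).symm⟩

theorem card_points [Fintype P] (h : IsGeneralizedQuadrangle 𝓛 s t) :
    Fintype.card P = (s + 1) * (s * t + 1) := by
  obtain ⟨x⟩ := h.nonempty
  obtain ⟨M, hM, -⟩ := h.exists_line x
  rw [← Nat.card_eq_fintype_card, ← Set.ncard_add_ncard_compl M, h.ncard_compl_line hM,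
    h.points_on M hM]
  ring

theorem card_lines [Fintype P] [Fintype 𝓛] (h : IsGeneralizedQuadrangle 𝓛 s t) :
    Fintype.card 𝓛 = (t + 1) * (s * t + 1) := by
  classical
  -- Incident point-line pairs counted in two ways.
  have key : Fintype.card P * (t + 1) = Fintype.card 𝓛 * (s + 1) := by
    refine Finset.card_mul_eq_card_mul (fun (x : P) (M : 𝓛) => x ∈ (M : Set P)) ?_ ?_
    · intro x _
      rw [← h.lines_through x, ← Set.ncard_coe_finset]
      refine Set.ncard_congr (fun M _ => (M : Set P)) ?_ ?_ ?_
      · intro M hM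
        simp [Finset.bipartiteAbove] at hM
        exact ⟨M.2, hM⟩
      · intro M M' _ _ hMM
        exact Subtype.ext hMM
      · rintro M ⟨hM, hx⟩
        exact ⟨⟨M, hM⟩, by simpa [Finset.bipartiteAbove] using hx, rfl⟩
    · intro M _
      rw [← h.points_on M M.2, ← Set.ncard_coe_finset]
      congr 1
      ext x
      simp [Finset.bipartiteBelow]
  rw [h.card_points] at key
  have : (s + 1) * Fintype.card 𝓛 = (s + 1) * ((t + 1) * (s * t + 1)) := by
    rw [mul_comm, ← key]; ring
  exact Nat.eq_of_mul_eq_mul_left (Nat.succ_pos s) this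

/-- A point `x` obstructs at most one point of a line `M`: every other point of `M` is joined to
`x` by no line except possibly `M`. -/
theorem exists_obstruction (h : IsGeneralizedQuadrangle 𝓛 s t) (x : P) {M : Set P}
    (hM : M ∈ 𝓛) :
    ∃ b : P, ∀ y ∈ M, y ≠ b → x ≠ y ∧ ∀ N ∈ 𝓛, x ∈ N → y ∈ N → N = M := by
  by_cases hx : x ∈ M
  · exact ⟨x, fun y hy hyx => ⟨hyx.symm, fun N hN hxN hyN =>
      h.line_unique x y hyx.symm N hN M hM hxN hyN hx hy⟩⟩
  · obtain ⟨⟨b, B⟩, -, hb⟩ := h.projection x M hM hx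
    refine ⟨b, fun y hy hyb => ⟨fun hxy => hx (hxy ▸ hy), fun N hN hxN hyN => ?_⟩⟩
    have := hb (y, N) ⟨hN, hyN, hxN, hy⟩
    exact absurd (congrArg Prod.fst this) hyb

/-- At most `s + 1` lines, with repetitions, admit points on them such that no further line joins
two of the points. -/
theorem exists_points (h : IsGeneralizedQuadrangle 𝓛 s t) (k : ℕ) (hk : k ≤ s + 1)
    (l : Fin k → Set P) (hl : ∀ a, l a ∈ 𝓛) :
    ∃ p : Fin k → P, (∀ a, p a ∈ l a) ∧ ∀ a a', a ≠ a' → p a ≠ p a' ∧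
      ∀ N ∈ 𝓛, p a ∈ N → p a' ∈ N → N = l a ∨ N = l a' := by
  classical
  induction k with
  | zero => exact ⟨Fin.elim0, fun a => a.elim0, fun a => a.elim0⟩
  | succ k ih =>
    obtain ⟨p, hp, hpp⟩ := ih (by omega) (fun a => l a.castSucc) fun a => hl _
    choose b hb using fun a : Fin k => h.exists_obstruction (p a) (hl (Fin.last k))
    -- The `k` earlier points obstruct at most `k ≤ s` of the `s + 1` points of the new line.
    obtain ⟨y, hy, hyb⟩ : ∃ y ∈ l (Fin.last k), y ∉ Set.range b := by
      refine Set.exists_mem_notMem_of_ncard_lt_ncard ?_ (Set.finite_range b)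
      rw [h.points_on _ (hl _), ← Set.image_univ]
      refine (Set.ncard_image_le (Set.finite_univ)).trans_lt ?_
      rw [Set.ncard_univ, Nat.card_fin]
      omega
    have hyb' : ∀ a, y ≠ b a := fun a hya => hyb ⟨a, hya.symm⟩
    refine ⟨Fin.snoc (α := fun _ => P) p y, fun a => ?_, fun a a' haa => ?_⟩
    · induction a using Fin.lastCases with
      | last => simpa using hy
      | cast a => simpa using hp a
    · induction a using Fin.lastCases with
      | last =>
        induction a' using Fin.lastCases with
        | last => exact absurd rfl haa
        | cast a' =>
          obtain ⟨h1, h2⟩ := hb a' y hy (hyb' a')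
          simp only [Fin.snoc_last, Fin.snoc_castSucc]
          exact ⟨h1.symm, fun N hN hyN hpN => Or.inl (h2 N hN hpN hyN)⟩
      | cast a =>
        induction a' using Fin.lastCases with
        | last =>
          obtain ⟨h1, h2⟩ := hb a y hy (hyb' a)
          simp only [Fin.snoc_last, Fin.snoc_castSucc]
          exact ⟨h1, fun N hN hpN hyN => Or.inr (h2 N hN hpN hyN)⟩
        | cast a' =>
          simp only [Fin.snoc_castSucc]
          exact hpp a a' fun h => haa (by rw [h])

end IsGeneralizedQuadrangle

/-! ### Recovery and the stacked code -/

/-- The message symbol at line `M` is determined by the parity symbol at a point `p` of `M` and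
the message symbols at the other lines through `p`. -/
theorem systematicCode_recover {F L P : Type*} [Field F] [Fintype L] {E : Matrix L P F}
    {x x' : L → F} {l : L} {p : P} (hE : E l p ≠ 0)
    (hp : systematicCode E x (Sum.inr p) = systematicCode E x' (Sum.inr p))
    (hl : ∀ l', l' ≠ l → E l' p ≠ 0 →
      systematicCode E x (Sum.inl l') = systematicCode E x' (Sum.inl l')) :
    x l = x' l := by
  classical
  simp only [systematicCode, Sum.elim_inr, Sum.elim_inl, Matrix.vecMul, dotProduct] at hp hl
  rw [← Finset.add_sum_erase _ _ (Finset.mem_univ l),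
    ← Finset.add_sum_erase (a := l) _ (fun i => x' i * E i p) (Finset.mem_univ l),
    Finset.sum_congr (g := fun i => x' i * E i p) rfl] at hp
  · exact mul_right_cancel₀ hE (add_right_cancel hp)
  · intro i hi
    by_cases h0 : E i p = 0
    · simp [h0]
    · rw [hl i (Finset.ne_of_mem_erase hi) h0]

theorem messageBlock_apply {F L : Type*} [Zero F] {n l : ℕ} (e : L ≃ Fin l) (x : Fin n → F)
    (i : Fin n) (hl : 0 < l) :
    messageBlock e x (i / l) (e.symm ⟨i % l, Nat.mod_lt _ hl⟩) = x i := by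
  have h : (i / l : ℕ) * l + i % l = i := Nat.div_add_mod' _ _
  have : (i / l : ℕ) * l + (e (e.symm ⟨i % l, Nat.mod_lt _ hl⟩) : ℕ) = i := by simpa using h
  unfold messageBlock
  rw [dif_pos (by rw [this]; exact i.2)]
  congr 1
  exact Fin.ext this

theorem IsGeneralizedQuadrangle.isMultisetBatchCode {P F : Type*} [Fintype P] {𝓛 : Set (Set P)}
    [Fintype 𝓛] [Field F] {s t n g k N m : ℕ} (h : IsGeneralizedQuadrangle 𝓛 s t) (hk : k ≤ s + 1)
    {E : Matrix 𝓛 P F} (hE : ∀ (M : 𝓛) (p : P), E M p ≠ 0 ↔ p ∈ (M : Set P))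
    (e : 𝓛 ≃ Fin (Fintype.card 𝓛)) (hg : 0 < g) (hn : n ≤ g * Fintype.card 𝓛)
    (hm : Fintype.card 𝓛 + Fintype.card P = m) (hN : N = g * m) :
    IsMultisetBatchCode n N k m 1 (stackedCode n g e (systematicCode E))
      (fun jv : Fin g × (𝓛 ⊕ P) => jv.2) where
  card_symbols := by rw [Fintype.card_prod, Fintype.card_sum, Fintype.card_fin, hm, hN]
  card_buckets := by rw [Fintype.card_sum, hm]
  bucket_nonempty b := ⟨(⟨0, hg⟩, b), rfl⟩
  serve r := by
    -- Without lines the message is empty, so no request exists.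
    rcases Nat.eq_zero_or_pos (Fintype.card 𝓛) with h0 | hl
    · rw [h0, mul_zero] at hn
      exact ⟨fun _ => ∅, fun a => absurd (r a).2 (by omega), by simp, by simp⟩
    let l : Fin k → 𝓛 := fun a => e.symm ⟨r a % Fintype.card 𝓛, Nat.mod_lt _ hl⟩
    let j : Fin k → Fin g := fun a => ⟨r a / Fintype.card 𝓛,
      (Nat.div_lt_iff_lt_mul hl).2 ((r a).2.trans_le hn)⟩
    obtain ⟨p, hp, hpp⟩ := h.exists_points k hk (fun a => l a) fun a => (l a).2
    -- The requested line is left out, so it may harmlessly join the chosen point to another one.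
    let B : Fin k → Set (𝓛 ⊕ P) := fun a =>
      insert (Sum.inr (p a)) (Sum.inl '' {M : 𝓛 | M ≠ l a ∧ p a ∈ (M : Set P)})
    have hB : ∀ a a', a ≠ a' → Disjoint (B a) (B a') := by
      intro a a' haa
      obtain ⟨h1, h2⟩ := hpp a a' haa
      rw [Set.disjoint_left]
      rintro v (rfl | ⟨M, ⟨hM, hpM⟩, rfl⟩) (hv | ⟨M', ⟨hM', hpM'⟩, hMM⟩)
      · exact h1 (Sum.inr_injective hv)
      · simp at hMM
      · simp at hv
      · obtain rfl := Sum.inl_injective hMM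
        rcases h2 M' M'.2 hpM hpM' with h3 | h3
        · exact hM (Subtype.ext h3)
        · exact hM' (Subtype.ext h3)
    have himg : ∀ a, ∀ b ∈ (fun jv : Fin g × (𝓛 ⊕ P) => jv.2) '' ({j a} ×ˢ B a), b ∈ B a := by
      rintro a _ ⟨⟨i, v⟩, ⟨-, hv⟩, rfl⟩
      exact hv
    refine ⟨fun a => {j a} ×ˢ B a, fun a => ?_, fun a a' haa =>
      (hB a a' haa).mono (himg a) (himg a'), fun b => ?_⟩
    -- A decoder exists as soon as equal readings force equal requested symbols; readings that never
    -- occur decode to `0`.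
    · refine ⟨Function.extend (fun (x : Fin n → F) (i : ({j a} ×ˢ B a : Set (Fin g × (𝓛 ⊕ P)))) =>
        stackedCode n g e (systematicCode E) x i) (fun x => x (r a)) (fun _ => 0), fun x => ?_⟩
      refine Function.FactorsThrough.extend_apply ?_ _ x
      intro x x' hxx
      have hxx' : ∀ v ∈ B a, systematicCode E (messageBlock e x (j a)) v =
          systematicCode E (messageBlock e x' (j a)) v := fun v hv =>
        congrFun hxx ⟨(j a, v), rfl, hv⟩
      have := systematicCode_recover ((hE (l a) (p a)).2 (hp a))
        (hxx' _ (Set.mem_insert _ _)) (fun l' hl' hEl => hxx' _ (Set.mem_insert_of_mem _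
          ⟨l', ⟨hl', (hE _ _).1 hEl⟩, rfl⟩))
      exact (messageBlock_apply e x (r a) hl).symm.trans
        (this.trans (messageBlock_apply e x' (r a) hl))
    -- Symbols read from one bucket belong to one request, hence to one copy.
    · rw [Set.ncard_le_one_iff]
      rintro ⟨i, v⟩ ⟨i', v'⟩ ⟨hv, a, hi, hva⟩ ⟨hv', a', hi', hva'⟩
      simp only [Set.mem_singleton_iff] at hv hv' hi hi' hva hva'
      subst hv hv'
      have : a = a' := by
        by_contra haa
        exact Set.disjoint_left.1 (hB a a' haa) hva hva'
      subst this
      rw [hi, hi']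

/-! ### Bucket count and rate -/

/-- The number of points and lines of a generalized quadrangle of order `(q ^ 2, q ^ 3)`, where
`k = q ^ 2`. -/
def bucketCount (k : ℕ) : ℕ :=
  k ^ 4 + (k.sqrt ^ 7 + 2 * k.sqrt ^ 5 + k.sqrt ^ 3 + k.sqrt ^ 2 + 2)

theorem bucketCount_sq (q : ℕ) :
    bucketCount (q ^ 2) = q ^ 8 + (q ^ 7 + 2 * q ^ 5 + q ^ 3 + q ^ 2 + 2) := by
  rw [bucketCount, Nat.sqrt_eq', ← pow_mul]

theorem tendsto_bucketCount :
    Tendsto (fun k : ℕ => (bucketCount k : ℝ) / (k : ℝ) ^ 4) atTop (𝓝 1) := by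
  have hs : Tendsto (fun k : ℕ => 1 + 8 / Real.sqrt k) atTop (𝓝 1) := by
    have h1 : Tendsto (fun k : ℕ => Real.sqrt k) atTop atTop :=
      Real.tendsto_sqrt_atTop.comp tendsto_natCast_atTop_atTop
    simpa using (h1.const_div_atTop 8).const_add 1
  refine tendsto_of_tendsto_of_tendsto_of_le_of_le' tendsto_const_nhds hs ?_ ?_
  · filter_upwards [eventually_gt_atTop 0] with k hk
    have hk : (0 : ℝ) < k := by exact_mod_cast hk
    rw [le_div_iff₀ (by positivity), one_mul]
    exact_mod_cast Nat.le_add_right _ _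
  · filter_upwards [eventually_gt_atTop 0] with k hk
    have hk' : (1 : ℝ) ≤ k := by exact_mod_cast hk
    set u := Real.sqrt k with hu
    have hu1 : 1 ≤ u := by rw [hu]; exact Real.one_le_sqrt.2 hk'
    have hku : (k : ℝ) = u ^ 2 := (Real.sq_sqrt (by positivity)).symm
    have hv : (k.sqrt : ℝ) ≤ u := Real.nat_sqrt_le_real_sqrt
    -- The limit runs over all `k`, so the integer square root is only bounded by `u`. The
    -- lower-order coefficients sum to `7`, so `8` is ample.
    have hb : (bucketCount k : ℝ) ≤ u ^ 8 + 8 * u ^ 7 := by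
      have e5 : u ^ 5 ≤ u ^ 7 := pow_le_pow_right₀ hu1 (by norm_num)
      have e3 : u ^ 3 ≤ u ^ 7 := pow_le_pow_right₀ hu1 (by norm_num)
      have e2 : u ^ 2 ≤ u ^ 7 := pow_le_pow_right₀ hu1 (by norm_num)
      have e0 : 1 ≤ u ^ 7 := one_le_pow₀ hu1
      have f7 : (k.sqrt : ℝ) ^ 7 ≤ u ^ 7 := by gcongr
      have f5 : (k.sqrt : ℝ) ^ 5 ≤ u ^ 5 := by gcongr
      have f3 : (k.sqrt : ℝ) ^ 3 ≤ u ^ 3 := by gcongr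
      have f2 : (k.sqrt : ℝ) ^ 2 ≤ u ^ 2 := by gcongr
      have g : (k : ℝ) ^ 4 = u ^ 8 := by rw [hku]; ring
      unfold bucketCount
      push_cast
      linarith
    rw [hku, div_le_iff₀ (by positivity)]
    refine hb.trans (le_of_eq ?_)
    field_simp

/-- The rate of the stacked code is at least `1 - 1 / q` for long messages. -/
theorem exists_rate_bound {q : ℕ} (hq : 2 ≤ q) :
    ∃ n₀ : ℕ, 0 < n₀ ∧ ∀ n ≥ n₀, 1 - 1 / (q : ℝ) ≤
      (n : ℝ) / (⌈(n : ℝ) / (q : ℝ) ^ 8⌉₊ * bucketCount (q ^ 2)) := by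
  refine ⟨q ^ 9 * bucketCount (q ^ 2), by rw [bucketCount_sq]; positivity, fun n hn => ?_⟩
  have hq' : (2 : ℝ) ≤ q := by exact_mod_cast hq
  have hm : (bucketCount (q ^ 2) : ℝ) =
      (q : ℝ) ^ 8 + ((q : ℝ) ^ 7 + 2 * (q : ℝ) ^ 5 + (q : ℝ) ^ 3 + (q : ℝ) ^ 2 + 2) := by
    rw [bucketCount_sq]; push_cast; ring
  have hn : (q : ℝ) ^ 9 * bucketCount (q ^ 2) ≤ n := by exact_mod_cast hn
  set Q : ℝ := (q : ℝ)
  set m : ℝ := (bucketCount (q ^ 2) : ℝ)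
  have hm0 : 0 < m := by rw [hm]; positivity
  have hn0 : 0 < (n : ℝ) := lt_of_lt_of_le (by positivity) hn
  have hc : (⌈(n : ℝ) / Q ^ 8⌉₊ : ℝ) ≤ n / Q ^ 8 + 1 := (Nat.ceil_lt_add_one (by positivity)).le
  have hc0 : 0 < (⌈(n : ℝ) / Q ^ 8⌉₊ : ℝ) := by
    exact_mod_cast Nat.ceil_pos.2 (by positivity)
  -- The slack `1`, multiplied by `n ≥ Q ^ 9 * m`, pays for rounding up the number of copies.
  have key : (Q - 1) * m + 1 ≤ Q ^ 9 := by
    rw [hm]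
    have h1 : 2 * Q ^ 6 ≤ Q ^ 7 := by
      have : Q ^ 7 = Q * Q ^ 6 := by ring
      rw [this]; gcongr
    have h2 : Q ^ 4 ≤ Q ^ 5 := pow_le_pow_right₀ (by linarith) (by norm_num)
    have h3 : 0 ≤ Q ^ 5 := by positivity
    nlinarith [sq_nonneg (Q - 1)]
  rw [le_div_iff₀ (by positivity)]
  have hQ : 1 - 1 / Q = (Q - 1) / Q := by field_simp
  rw [hQ]
  have hQ1 : 0 ≤ (Q - 1) / Q := div_nonneg (by linarith) (by linarith)
  calc (Q - 1) / Q * (⌈(n : ℝ) / Q ^ 8⌉₊ * m) ≤ (Q - 1) / Q * ((n / Q ^ 8 + 1) * m) := by gcongr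
    _ = (Q - 1) * m * (n + Q ^ 8) / Q ^ 9 := by field_simp
    _ ≤ n := by
      rw [div_le_iff₀ (by positivity)]
      have h1 : (Q - 1) * m * Q ^ 8 ≤ Q ^ 9 * m := by
        have : 0 ≤ m * Q ^ 8 := by positivity
        linear_combination this
      linear_combination h1 + hn + mul_le_mul_of_nonneg_right key hn0.le

/-! ### Trace and norm fibres, isotropic vectors -/

/-- If the fibres of `f : s → t` have at most `a` elements, `t` has at most `b` elements and `s` at
least `a * b`, then all fibres have exactly `a` elements. -/
theorem Finset.card_fiber_eq_of_le {α β : Type*} [DecidableEq β] {s : Finset α} {t : Finset β}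
    {f : α → β} {a b : ℕ} (hf : Set.MapsTo f s t) (ht : t.card ≤ b)
    (hfib : ∀ y ∈ t, (s.filter fun x => f x = y).card ≤ a) (hs : a * b ≤ s.card) {y : β}
    (hy : y ∈ t) : (s.filter fun x => f x = y).card = a := by
  by_contra hne
  have h1 := Finset.card_eq_sum_card_fiberwise hf
  have h2 := Finset.sum_lt_sum hfib ⟨y, hy, lt_of_le_of_ne (hfib y hy) hne⟩
  rw [Finset.sum_const, smul_eq_mul] at h2
  have h3 := Nat.mul_le_mul_right a ht
  rw [mul_comm b] at h3
  omega

theorem Polynomial.card_filter_X_pow_add_le {K : Type*} [Field K] [Fintype K] [DecidableEq K]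
    {n : ℕ} {r : Polynomial K} (hr : r.degree < n) :
    (Finset.univ.filter fun x : K => x ^ n + r.eval x = 0).card ≤ n := by
  have hm := Polynomial.monic_X_pow_add hr
  refine (Polynomial.card_le_degree_of_subset_roots (p := Polynomial.X ^ n + r) ?_).trans
    (Polynomial.natDegree_le_iff_degree_le.2 (le_of_eq ?_))
  swap
  · rw [Polynomial.degree_add_eq_left_of_degree_lt (by rwa [Polynomial.degree_X_pow]),
      Polynomial.degree_X_pow]
  intro x hx
  rw [Polynomial.mem_roots hm.ne_zero, Polynomial.IsRoot.def]
  simpa using hx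

section Counting

variable {K : Type*} [Field K] [Fintype K] {q : ℕ} {σ : K →+* K}

theorem frobenius_involutive (hσ : ∀ x, σ x = x ^ q) (hK : Fintype.card K = q ^ 2) (x : K) :
    σ (σ x) = x := by
  rw [hσ, hσ, ← pow_mul, ← sq, ← hK, FiniteField.pow_card]

variable [DecidableEq K]

theorem card_fixed_le (hq : 2 ≤ q) : (Finset.univ.filter fun x : K => x ^ q = x).card ≤ q := by
  refine (Finset.card_le_card ?_).trans
    (Polynomial.card_filter_X_pow_add_le (n := q) (r := -Polynomial.X) ?_)
  · intro x
    simp only [Finset.mem_filter, Finset.mem_univ, true_and, Polynomial.eval_neg,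
      Polynomial.eval_X]
    intro h
    rw [h, add_neg_cancel]
  · rw [Polynomial.degree_neg, Polynomial.degree_X]
    exact_mod_cast (by omega : 1 < q)

/-- The trace sends `q ^ 2` elements to at most `q` fixed ones, and a fibre lies in the roots of a
polynomial of degree `q`; both bounds must be attained. -/
theorem card_trace_fiber (hσ : ∀ x, σ x = x ^ q) (hK : Fintype.card K = q ^ 2) (hq : 2 ≤ q)
    {c : K} (hc : c ^ q = c) : (Finset.univ.filter fun x : K => x + σ x = c).card = q := by
  refine Finset.card_fiber_eq_of_le (t := Finset.univ.filter fun x : K => x ^ q = x) (a := q)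
    (b := q) ?_ (card_fixed_le hq) ?_ ?_ (by simpa using hc)
  · intro x _
    simp only [Finset.coe_filter, Finset.mem_univ, true_and, Set.mem_ofPred_eq]
    rw [← hσ, map_add, frobenius_involutive hσ hK, add_comm]
  · intro y _
    refine (Finset.card_le_card ?_).trans
      (Polynomial.card_filter_X_pow_add_le (n := q) (r := Polynomial.X - Polynomial.C y) ?_)
    · intro x
      simp only [Finset.mem_filter, Finset.mem_univ, true_and, Polynomial.eval_sub,
        Polynomial.eval_X, Polynomial.eval_C]
      intro h
      rw [← h, hσ]
      ring
    · rw [Polynomial.degree_X_sub_C]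
      exact_mod_cast (by omega : 1 < q)
  · rw [Finset.card_univ, hK, sq]

/-- The same pigeonhole on nonzero elements, with `q ^ 2 - 1 = (q + 1) * (q - 1)`. -/
theorem card_norm_fiber (hσ : ∀ x, σ x = x ^ q) (hK : Fintype.card K = q ^ 2) (hq : 2 ≤ q)
    {c : K} (hc : c ^ q = c) (hc0 : c ≠ 0) :
    (Finset.univ.filter fun x : K => x ^ (q + 1) = c).card = q + 1 := by
  have h : (Finset.univ.filter fun x : K => x ^ (q + 1) = c) =
      (Finset.univ.erase (0 : K)).filter fun x : K => x ^ (q + 1) = c := by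
    ext x
    simp only [Finset.mem_filter, Finset.mem_univ, true_and, Finset.mem_erase, and_true]
    refine ⟨fun h => ⟨?_, h⟩, fun h => h.2⟩
    rintro rfl
    exact hc0 (by rw [← h, zero_pow q.succ_ne_zero])
  rw [h]
  refine Finset.card_fiber_eq_of_le (t := (Finset.univ.filter fun x : K => x ^ q = x).erase 0)
    (a := q + 1) (b := q - 1) ?_ ?_ ?_ ?_ (by simpa using ⟨hc0, hc⟩)
  · intro x hx
    have hx : x ≠ 0 := by simpa using hx
    simp only [Finset.coe_erase, Finset.coe_filter, Finset.mem_univ, true_and, Set.mem_sdiff,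
      Set.mem_ofPred_eq, Set.mem_singleton_iff]
    refine ⟨?_, pow_ne_zero _ hx⟩
    rw [← hσ, pow_succ, map_mul, ← hσ, frobenius_involutive hσ hK, mul_comm]
  · rw [Finset.card_erase_of_mem (by simp; omega)]
    exact Nat.sub_le_sub_right (card_fixed_le hq) 1
  · intro y _
    refine (Finset.card_le_card ?_).trans
      (Polynomial.card_filter_X_pow_add_le (n := q + 1) (r := -Polynomial.C y) ?_)
    · intro x
      simp only [Finset.mem_filter, Finset.mem_univ, true_and, Polynomial.eval_neg,
        Polynomial.eval_C]
      rintro ⟨-, h⟩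
      rw [h, add_neg_cancel]
    · rw [Polynomial.degree_neg]
      exact Polynomial.degree_C_le.trans_lt (by exact_mod_cast q.succ_pos)
  · rw [Finset.card_erase_of_mem (Finset.mem_univ _), Finset.card_univ, hK]
    obtain ⟨r, rfl⟩ : ∃ r, q = r + 1 := ⟨q - 1, by omega⟩
    simp only [Nat.add_sub_cancel]
    apply le_of_eq
    rw [eq_comm, Nat.sub_eq_iff_eq_add (Nat.one_le_pow _ _ r.add_one_pos)]
    ring

omit [DecidableEq K] in
theorem sum_norm_fixed (hσ : ∀ x, σ x = x ^ q) (hK : Fintype.card K = q ^ 2) {ι : Type*}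
    [Fintype ι] (v : ι → K) : (∑ i, v i ^ (q + 1)) ^ q = ∑ i, v i ^ (q + 1) := by
  rw [← hσ, map_sum]
  refine Finset.sum_congr rfl fun i _ => ?_
  rw [pow_succ, map_mul, ← hσ, frobenius_involutive hσ hK, mul_comm]

/-- The number of isotropic vectors of the standard Hermitian form, by recursion on the
dimension. -/
theorem card_isotropic_succ (hσ : ∀ x, σ x = x ^ q) (hK : Fintype.card K = q ^ 2) (hq : 2 ≤ q)
    (n : ℕ) :
    (Finset.univ.filter fun v : Fin (n + 1) → K => ∑ i, v i ^ (q + 1) = 0).card +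
      q * (Finset.univ.filter fun v : Fin n → K => ∑ i, v i ^ (q + 1) = 0).card =
      (q + 1) * (q ^ 2) ^ n := by
  -- The first coordinate must have norm minus the form at the tail: one choice if that is zero, a
  -- full norm fibre otherwise.
  have hfib : ∀ w : Fin n → K,
      ((Finset.univ.filter fun v : Fin (n + 1) → K => ∑ i, v i ^ (q + 1) = 0).filter
        fun v => Fin.tail v = w).card = if ∑ i, w i ^ (q + 1) = 0 then 1 else q + 1 := by
    intro w
    have h1 : ((Finset.univ.filter fun v : Fin (n + 1) → K => ∑ i, v i ^ (q + 1) = 0).filter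
        fun v => Fin.tail v = w).card =
        (Finset.univ.filter fun x : K => x ^ (q + 1) = -∑ i, w i ^ (q + 1)).card := by
      refine Finset.card_nbij' (fun v => v 0) (fun x => Fin.cons x w) ?_ ?_ ?_ ?_
      · intro v hv
        simp only [Finset.coe_filter, Finset.mem_filter, Finset.mem_univ, true_and,
          Set.mem_ofPred_eq, Fin.sum_univ_succ] at hv ⊢
        obtain ⟨hv, rfl⟩ := hv
        exact eq_neg_of_add_eq_zero_left hv
      · intro x hx
        simp only [Finset.coe_filter, Finset.mem_filter, Finset.mem_univ, true_and,
          Set.mem_ofPred_eq, Fin.sum_univ_succ, Fin.cons_zero, Fin.cons_succ, Fin.tail_cons,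
          and_true] at hx ⊢
        rw [hx, neg_add_cancel]
      · intro v hv
        simp only [Finset.coe_filter, Finset.mem_filter, Finset.mem_univ, true_and,
          Set.mem_ofPred_eq] at hv
        rw [← hv.2]
        exact Fin.cons_self_tail v
      · intro x _
        rfl
    rw [h1]
    split_ifs with h0
    · rw [h0, neg_zero, Finset.card_eq_one]
      exact ⟨0, by ext x; simp⟩
    · refine card_norm_fiber hσ hK hq ?_ (neg_ne_zero.2 h0)
      rw [← hσ, map_neg, hσ, sum_norm_fixed hσ hK]
  rw [Finset.card_eq_sum_card_fiberwise (f := Fin.tail) (t := Finset.univ) (fun _ _ => by simp),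
    Finset.sum_congr rfl fun w _ => hfib w, Finset.card_filter, Finset.mul_sum,
    ← Finset.sum_add_distrib, Finset.sum_congr (g := fun _ => q + 1) rfl, Finset.sum_const,
    Finset.card_univ, Fintype.card_fun, hK, Fintype.card_fin, smul_eq_mul, mul_comm]
  intro w _
  split_ifs <;> ring

theorem card_isotropic_five (hσ : ∀ x, σ x = x ^ q) (hK : Fintype.card K = q ^ 2) (hq : 2 ≤ q) :
    (Finset.univ.filter fun v : Fin 5 → K => ∑ i, v i ^ (q + 1) = 0).card + q ^ 5 =
      q ^ 9 + q ^ 4 := by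
  have h0 : (Finset.univ.filter fun v : Fin 0 → K => ∑ i, v i ^ (q + 1) = 0).card = 1 := by simp
  have h1 := card_isotropic_succ hσ hK hq 0
  have h2 := card_isotropic_succ hσ hK hq 1
  have h3 := card_isotropic_succ hσ hK hq 2
  have h4 := card_isotropic_succ hσ hK hq 3
  have h5 := card_isotropic_succ hσ hK hq 4
  rw [h0] at h1
  zify at *
  -- Weights `(-q) ^ j` telescope the recursion.
  linear_combination h5 - q * h4 + q ^ 2 * h3 - q ^ 3 * h2 + q ^ 4 * h1

end Counting

/-! ### The Hermitian form -/

section Form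

variable {K : Type*} [Field K] {ι : Type*} [Fintype ι] [DecidableEq ι] {q : ℕ} (σ : K →+* K)

/-- The linear functional `u ↦ ∑ σ (vᵢ) uᵢ`. -/
def hermitianDual (v : ι → K) : Module.Dual K (ι → K) :=
  dotProductEquiv K ι fun i => σ (v i)

theorem hermitianDual_apply (v u : ι → K) : hermitianDual σ v u = ∑ i, σ (v i) * u i := rfl

theorem hermitianDual_add (v w : ι → K) :
    hermitianDual σ (v + w) = hermitianDual σ v + hermitianDual σ w := by
  refine LinearMap.ext fun u => ?_
  simp only [hermitianDual_apply, LinearMap.add_apply, Pi.add_apply, map_add, add_mul,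
    Finset.sum_add_distrib]

theorem hermitianDual_smul (a : K) (v : ι → K) :
    hermitianDual σ (a • v) = σ a • hermitianDual σ v := by
  refine LinearMap.ext fun u => ?_
  simp only [hermitianDual_apply, LinearMap.smul_apply, Pi.smul_apply, smul_eq_mul, map_mul,
    mul_assoc, Finset.mul_sum]

theorem hermitianDual_injective :
    Function.Injective (hermitianDual σ : (ι → K) → Module.Dual K (ι → K)) := by
  intro v w h
  have := (dotProductEquiv K ι).injective h
  ext i
  exact σ.injective (congrFun this i)

variable {σ}

theorem hermitianDual_self (hσ : ∀ x, σ x = x ^ q) (v : ι → K) :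
    hermitianDual σ v v = ∑ i, v i ^ (q + 1) := by
  simp [hermitianDual_apply, hσ, pow_succ]

variable [Fintype K]

theorem hermitianDual_symm (hσ : ∀ x, σ x = x ^ q) (hK : Fintype.card K = q ^ 2) (v w : ι → K) :
    σ (hermitianDual σ v w) = hermitianDual σ w v := by
  simp only [hermitianDual_apply, map_sum, map_mul, frobenius_involutive hσ hK, mul_comm]

/-- The cross terms form a trace, so isotropy along a line in direction `x` becomes a trace equation
when `x` is isotropic. -/
theorem hermitianDual_add_smul_self (hσ : ∀ x, σ x = x ^ q) (hK : Fintype.card K = q ^ 2)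
    (v x : ι → K) (a : K) :
    hermitianDual σ (v + a • x) (v + a • x) = hermitianDual σ v v +
      (a * hermitianDual σ v x + σ (a * hermitianDual σ v x)) +
      a * σ a * hermitianDual σ x x := by
  simp only [hermitianDual_add, hermitianDual_smul, map_add, map_smul, LinearMap.add_apply,
    LinearMap.smul_apply, smul_eq_mul, map_mul, hermitianDual_symm hσ hK]
  ring

/-- A subspace of isotropic vectors is totally isotropic. -/
theorem hermitianDual_eq_zero (hσ : ∀ x, σ x = x ^ q) (hK : Fintype.card K = q ^ 2) (hq : 2 ≤ q)
    {W : Submodule K (ι → K)} (hW : ∀ v ∈ W, ∑ i, v i ^ (q + 1) = 0) {v w : ι → K} (hv : v ∈ W)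
    (hw : w ∈ W) : hermitianDual σ v w = 0 := by
  classical
  by_contra hc
  -- A nonzero value of the form would let the cross term take every value in `K`, making the trace
  -- vanish identically, although its kernel has only `q` elements.
  have h0 := card_trace_fiber hσ hK hq (zero_pow (by omega) : (0 : K) ^ q = 0)
  have h1 : (Finset.univ.filter fun x : K => x + σ x = 0) = Finset.univ := by
    rw [Finset.filter_eq_self]
    intro x _
    have h2 := hermitianDual_add_smul_self hσ hK v w (x / hermitianDual σ v w)
    rw [hermitianDual_self hσ, hermitianDual_self hσ, hermitianDual_self hσ, hW v hv, hW w hw,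
      hW _ (W.add_mem hv (W.smul_mem _ hw)), div_mul_cancel₀ _ hc] at h2
    simpa using h2.symm
  rw [h1, Finset.card_univ, hK] at h0
  nlinarith

/-- The Witt index is at most half the dimension. -/
theorem two_mul_finrank_le (hσ : ∀ x, σ x = x ^ q) (hK : Fintype.card K = q ^ 2) (hq : 2 ≤ q)
    {W : Submodule K (ι → K)} (hW : ∀ v ∈ W, ∑ i, v i ^ (q + 1) = 0) :
    2 * Module.finrank K W ≤ Fintype.card ι := by
  classical
  have h1 := Subspace.finrank_add_finrank_dualAnnihilator_eq W
  rw [Module.finrank_fintype_fun_eq_card] at h1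
  have : Finite (Module.Dual K (ι → K)) := Module.finite_of_finite K
  -- The map to the annihilator is only semilinear, so cardinalities are compared instead of
  -- dimensions.
  have h2 : Nat.card W ≤ Nat.card W.dualAnnihilator := by
    refine Nat.card_le_card_of_injective (fun w : W => (⟨hermitianDual σ w.1, ?_⟩ :
      W.dualAnnihilator)) ?_
    · rw [Submodule.mem_dualAnnihilator]
      exact fun v hv => hermitianDual_eq_zero hσ hK hq hW w.2 hv
    · intro w w' h
      exact Subtype.ext (hermitianDual_injective σ (congrArg Subtype.val h))
  rw [Module.natCard_eq_pow_finrank (K := K) (V := W),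
    Module.natCard_eq_pow_finrank (K := K) (V := W.dualAnnihilator)] at h2
  have := (Nat.pow_le_pow_iff_right (Finite.one_lt_card (α := K))).1 h2
  omega

/-- A totally isotropic subspace extended by an orthogonal isotropic vector is totally
isotropic. -/
theorem isotropic_sup_span (hσ : ∀ x, σ x = x ^ q) (hK : Fintype.card K = q ^ 2)
    {W : Submodule K (ι → K)} (hW : ∀ v ∈ W, ∑ i, v i ^ (q + 1) = 0) {x : ι → K}
    (hx : ∑ i, x i ^ (q + 1) = 0) (hWx : ∀ v ∈ W, hermitianDual σ x v = 0) :
    ∀ v ∈ W ⊔ K ∙ x, ∑ i, v i ^ (q + 1) = 0 := by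
  intro v hv
  obtain ⟨w, hw, y, hy, rfl⟩ := Submodule.mem_sup.1 hv
  obtain ⟨a, rfl⟩ := Submodule.mem_span_singleton.1 hy
  have h := hermitianDual_symm hσ hK x w
  rw [← hermitianDual_self hσ, hermitianDual_add_smul_self hσ hK, hermitianDual_self hσ,
    hermitianDual_self hσ, hW w hw, hx, ← h, hWx w hw]
  simp

omit [DecidableEq ι] [Fintype K] in
theorem isotropic_span_singleton {x : ι → K} (hx : ∑ i, x i ^ (q + 1) = 0) :
    ∀ v ∈ K ∙ x, ∑ i, v i ^ (q + 1) = 0 := by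
  intro v hv
  obtain ⟨a, rfl⟩ := Submodule.mem_span_singleton.1 hv
  simp [mul_pow, ← Finset.mul_sum, hx]

/-- The number of isotropic vectors not orthogonal to the isotropic vector `x`. -/
theorem card_isotropic_not_orthogonal [DecidableEq K] (hσ : ∀ x, σ x = x ^ q)
    (hK : Fintype.card K = q ^ 2) (hq : 2 ≤ q) {x : ι → K} (hx : ∑ i, x i ^ (q + 1) = 0) :
    (Finset.univ.filter fun v : ι → K => hermitianDual σ x v ≠ 0).card * q =
      q ^ 2 * (Finset.univ.filter fun v : ι → K =>
        hermitianDual σ x v ≠ 0 ∧ ∑ i, v i ^ (q + 1) = 0).card := by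
  have hxx : hermitianDual σ x x = 0 := by rw [hermitianDual_self hσ, hx]
  have hxa : ∀ v (a : K), hermitianDual σ x (v + a • x) = hermitianDual σ x v := by
    intro v a
    rw [map_add, map_smul, hxx, smul_zero, add_zero]
  rw [← hK, ← Finset.card_univ]
  -- Count pairs `(v, a)` with `v + a • x` isotropic: each `v` admits `q` scalars by the trace
  -- equation, and for each `a` translation by `a • x` is a bijection.
  refine Finset.card_mul_eq_card_mul
    (fun (v : ι → K) (a : K) => ∑ i, (v + a • x) i ^ (q + 1) = 0) ?_ ?_
  · intro v hv
    have hv : hermitianDual σ x v ≠ 0 := by simpa using hv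
    have hv' : hermitianDual σ v x ≠ 0 := by
      rw [← hermitianDual_symm hσ hK]
      exact (map_ne_zero σ).2 hv
    have hc : (-hermitianDual σ v v) ^ q = -hermitianDual σ v v := by
      rw [← hσ, map_neg, hermitianDual_symm hσ hK]
    refine Eq.trans ?_ (card_trace_fiber hσ hK hq hc)
    refine Finset.card_nbij' (fun a => a * hermitianDual σ v x)
      (fun a => a / hermitianDual σ v x) ?_ ?_ ?_ ?_
    · intro a ha
      simp only [Finset.bipartiteAbove, Finset.coe_filter, Finset.mem_univ, true_and,
        Set.mem_ofPred_eq] at ha ⊢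
      rw [← hermitianDual_self hσ, hermitianDual_add_smul_self hσ hK, hxx, mul_zero, add_zero]
        at ha
      exact eq_neg_of_add_eq_zero_right ha
    · intro a ha
      simp only [Finset.bipartiteAbove, Finset.coe_filter, Finset.mem_univ, true_and,
        Set.mem_ofPred_eq] at ha ⊢
      rw [← hermitianDual_self hσ, hermitianDual_add_smul_self hσ hK, hxx, mul_zero, add_zero,
        div_mul_cancel₀ _ hv', ha, add_neg_cancel]
    · intro a _
      exact mul_div_cancel_right₀ a hv'
    · intro a _
      exact div_mul_cancel₀ a hv'
  · intro a _
    refine Finset.card_nbij' (fun v => v + a • x) (fun v => v - a • x) ?_ ?_ ?_ ?_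
    · intro v hv
      simp only [Finset.bipartiteBelow, Finset.coe_filter, Finset.mem_filter, Finset.mem_univ,
        true_and, Set.mem_ofPred_eq] at hv ⊢
      rwa [hxa]
    · intro v hv
      simp only [Finset.bipartiteBelow, Finset.coe_filter, Finset.mem_filter, Finset.mem_univ,
        true_and, Set.mem_ofPred_eq] at hv ⊢
      rwa [sub_add_cancel, ← hxa _ a, sub_add_cancel]
    · intro v _
      exact add_sub_cancel_right v _
    · intro v _
      exact sub_add_cancel v _

/-- The number of isotropic vectors orthogonal to, but not in the span of, the isotropic vector
`x`. -/
theorem ncard_isotropic_orthogonal (hσ : ∀ x, σ x = x ^ q) (hK : Fintype.card K = q ^ 2)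
    (hq : 2 ≤ q) {x : Fin 5 → K} (hx : ∑ i, x i ^ (q + 1) = 0) (hx0 : x ≠ 0) :
    {v : Fin 5 → K | (∑ i, v i ^ (q + 1) = 0 ∧ hermitianDual σ x v = 0) ∧ v ∉ K ∙ x}.ncard +
      (q ^ 3 + 1) * q ^ 2 = (q ^ 3 + 1) * q ^ 4 := by
  classical
  have hf : hermitianDual σ x ≠ 0 := fun h => hx0 (hermitianDual_injective σ (by
    rw [h]
    refine LinearMap.ext fun u => ?_
    simp [hermitianDual_apply]))
  have hker := Module.Dual.finrank_ker_add_one_of_ne_zero hf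
  rw [Module.finrank_fintype_fun_eq_card, Fintype.card_fin] at hker
  have hker' : (Finset.univ.filter fun v : Fin 5 → K => hermitianDual σ x v = 0).card = q ^ 8 := by
    have h1 := Module.natCard_eq_pow_finrank (K := K) (V := LinearMap.ker (hermitianDual σ x))
    rw [show Module.finrank K (LinearMap.ker (hermitianDual σ x)) = 4 by omega,
      Nat.card_eq_fintype_card (α := K), hK, ← pow_mul] at h1
    have h2 : ((Finset.univ.filter fun v : Fin 5 → K => hermitianDual σ x v = 0 : Finset _) :
        Set (Fin 5 → K)) = LinearMap.ker (hermitianDual σ x) := by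
      ext v
      simp
    rw [← Set.ncard_coe_finset, h2]
    exact h1
  have hspan : (K ∙ x : Set (Fin 5 → K)).ncard = q ^ 2 := by
    have h1 := Module.natCard_eq_pow_finrank (K := K) (V := K ∙ x)
    rw [finrank_span_singleton hx0, Nat.card_eq_fintype_card (α := K), hK, pow_one] at h1
    rw [← h1]
    rfl
  have hall : (Finset.univ : Finset (Fin 5 → K)).card = q ^ 10 := by
    rw [Finset.card_univ, Fintype.card_fun, hK, Fintype.card_fin, ← pow_mul]
  have h1 := Finset.card_filter_add_card_filter_not (s := (Finset.univ : Finset (Fin 5 → K)))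
    fun v => hermitianDual σ x v = 0
  have h2 := Finset.card_filter_add_card_filter_not
    (s := Finset.univ.filter fun v : Fin 5 → K => ∑ i, v i ^ (q + 1) = 0)
    fun v => hermitianDual σ x v = 0
  have h3 := card_isotropic_not_orthogonal hσ hK hq hx
  have h4 := card_isotropic_five hσ hK hq
  rw [hker', hall] at h1
  rw [Finset.filter_filter, Finset.filter_filter] at h2
  have h5 : {v : Fin 5 → K | (∑ i, v i ^ (q + 1) = 0 ∧ hermitianDual σ x v = 0) ∧
      v ∉ K ∙ x}.ncard + q ^ 2 = (Finset.univ.filter fun v : Fin 5 → K =>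
        ∑ i, v i ^ (q + 1) = 0 ∧ hermitianDual σ x v = 0).card := by
    have h6 := isotropic_span_singleton hx
    have h7 : (K ∙ x : Set (Fin 5 → K)) ⊆ {v | ∑ i, v i ^ (q + 1) = 0 ∧ hermitianDual σ x v = 0} :=
      fun v hv => ⟨h6 v hv, hermitianDual_eq_zero hσ hK hq h6 (Submodule.mem_span_singleton_self x)
        hv⟩
    rw [← hspan, ← Set.ncard_coe_finset, Finset.coe_filter_univ,
      ← Set.ncard_sdiff_add_ncard_of_subset h7]
    rfl
  simp only [and_comm (a := hermitianDual σ x _ ≠ 0), ne_eq] at h3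
  set A := (Finset.univ.filter fun v : Fin 5 → K => ¬hermitianDual σ x v = 0).card
  set B := (Finset.univ.filter fun v : Fin 5 → K =>
    ∑ i, v i ^ (q + 1) = 0 ∧ ¬hermitianDual σ x v = 0).card
  have h6 : A = q * B := by
    have : q * A = q * (q * B) := by linear_combination h3
    exact Nat.eq_of_mul_eq_mul_left (by omega) this
  -- There are `q ^ 10 - q ^ 8` vectors not orthogonal to `x`, and a fraction `1 / q` of them is
  -- isotropic.
  have h7 : B + q ^ 7 = q ^ 9 := by
    have : q * (B + q ^ 7) = q * q ^ 9 := by linear_combination h1 - h6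
    exact Nat.eq_of_mul_eq_mul_left (by omega) this
  zify at *
  linear_combination h5 + h2 + h4 - h7

end Form

/-- The cardinality forces the characteristic to be the prime below `q`, so the `q`-th power is an
iterated Frobenius. -/
theorem exists_frobenius {K : Type*} [Field K] [Fintype K] {q : ℕ} (hq : IsPrimePow q)
    (hK : Fintype.card K = q ^ 2) : ∃ σ : K →+* K, ∀ x, σ x = x ^ q := by
  obtain ⟨p, e, hp, he, rfl⟩ := hq
  have hp := hp.nat_prime
  obtain ⟨r, hr, n, hrp, hn⟩ := FiniteField.card' K
  have : r = p := by
    rw [hn, ← pow_mul] at hK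
    have h1 : r ∣ p ^ (e * 2) := hK ▸ dvd_pow_self r n.ne_zero
    exact (Nat.prime_dvd_prime_iff_eq hrp hp).1 (hrp.dvd_of_dvd_pow h1)
  subst this
  have := Fact.mk hp
  exact ⟨iterateFrobenius K r e, fun x => rfl⟩

/-! ### Points and lines of the Hermitian variety -/

namespace HermitianPoint

variable {q : ℕ} {K : Type*} [Field K]

/-- The points of the Hermitian variety on a subspace. -/
def pointsOf (q : ℕ) (W : Submodule K (Fin 5 → K)) : Set (HermitianPoint q K) :=
  {p | p.1.submodule ≤ W}

theorem mem_pointsOf {W : Submodule K (Fin 5 → K)} {p : HermitianPoint q K} :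
    p ∈ pointsOf q W ↔ p.1.rep ∈ W := by
  rw [pointsOf, Set.mem_ofPred_eq, Projectivization.submodule_eq, Submodule.span_singleton_le_iff_mem]

theorem isotropic_rep (p : HermitianPoint q K) : ∑ i, p.1.rep i ^ (q + 1) = 0 :=
  p.2 _ (by rw [Projectivization.submodule_eq]; exact Submodule.mem_span_singleton_self _)

/-- The point spanned by an isotropic vector. -/
def mk (v : Fin 5 → K) (hv : v ≠ 0) (h : ∑ i, v i ^ (q + 1) = 0) : HermitianPoint q K :=
  ⟨Projectivization.mk K v hv, by
    rw [Projectivization.submodule_mk]; exact isotropic_span_singleton h⟩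

/-- Each nonzero vector of `W` spans a point of the variety. Hence lines as point sets can be
counted as subspaces. -/
theorem le_of_pointsOf_subset {W W' : Submodule K (Fin 5 → K)}
    (hW : ∀ v ∈ W, ∑ i, v i ^ (q + 1) = 0) (h : pointsOf q W ⊆ pointsOf q W') : W ≤ W' := by
  intro v hv
  by_cases h0 : v = 0
  · rw [h0]; exact W'.zero_mem
  · have : mk v h0 (hW v hv) ∈ pointsOf q W' := h (by
      rw [pointsOf, Set.mem_ofPred_eq, mk, Projectivization.submodule_mk,
        Submodule.span_singleton_le_iff_mem]
      exact hv)
    rwa [pointsOf, Set.mem_ofPred_eq, mk, Projectivization.submodule_mk,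
      Submodule.span_singleton_le_iff_mem] at this

theorem rep_notMem_span {p r : HermitianPoint q K} (h : p ≠ r) : r.1.rep ∉ K ∙ p.1.rep := by
  intro hr
  rw [← Submodule.span_singleton_le_iff_mem, ← Projectivization.submodule_eq,
    ← Projectivization.submodule_eq] at hr
  have := Submodule.eq_of_le_of_finrank_eq hr (by simp [Projectivization.finrank_submodule])
  exact h (Subtype.ext (Projectivization.submodule_injective this.symm))

theorem finrank_span_pair {V : Type*} [AddCommGroup V] [Module K V] [Module.Finite K V] {x v : V}
    (hx : x ≠ 0) (hv : v ∉ K ∙ x) : Module.finrank K ((K ∙ x) ⊔ K ∙ v : Submodule K V) = 2 := by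
  rw [Submodule.finrank_sup_span_singleton hv, finrank_span_singleton hx]

theorem span_pair_eq {V : Type*} [AddCommGroup V] [Module K V] [Module.Finite K V] {x v : V}
    (hx : x ≠ 0) (hv : v ∉ K ∙ x) {W : Submodule K V} (hW : Module.finrank K W = 2) (hxW : x ∈ W)
    (hvW : v ∈ W) : (K ∙ x) ⊔ K ∙ v = W := by
  refine Submodule.eq_of_le_of_finrank_eq (sup_le ?_ ?_) (by rw [hW, finrank_span_pair hx hv])
  · rwa [Submodule.span_singleton_le_iff_mem]
  · rwa [Submodule.span_singleton_le_iff_mem]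

/-- Two distinct points span a unique line. -/
theorem line_eq {p r : HermitianPoint q K} (h : p ≠ r) {W W' : Submodule K (Fin 5 → K)}
    (hW : Module.finrank K W = 2) (hW' : Module.finrank K W' = 2) (hp : p ∈ pointsOf q W)
    (hr : r ∈ pointsOf q W) (hp' : p ∈ pointsOf q W') (hr' : r ∈ pointsOf q W') : W = W' := by
  rw [mem_pointsOf] at *
  rw [← span_pair_eq p.1.rep_nonzero (rep_notMem_span h) hW hp hr,
    span_pair_eq p.1.rep_nonzero (rep_notMem_span h) hW' hp' hr']

variable [Fintype K]

theorem ncard_pointsOf (hK : Fintype.card K = q ^ 2) {W : Submodule K (Fin 5 → K)}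
    (hW2 : Module.finrank K W = 2) (hW : ∀ v ∈ W, ∑ i, v i ^ (q + 1) = 0) :
    (pointsOf q W).ncard = q ^ 2 + 1 := by
  have h1 := Projectivization.card_of_finrank_two K W hW2
  rw [Nat.card_eq_fintype_card (α := K), hK] at h1
  have hmap : ∀ p : ℙ K W, (p.map W.subtype W.injective_subtype).submodule ≤ W := by
    intro p
    induction p with
    | h v hv =>
      rw [Projectivization.map_mk, Projectivization.submodule_mk,
        Submodule.span_singleton_le_iff_mem]
      exact v.2
  let f : ℙ K W → HermitianPoint q K := fun p =>
    ⟨p.map W.subtype W.injective_subtype, fun v hv => hW v (hmap p hv)⟩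
  have hf : Function.Injective f := fun p r h =>
    Projectivization.map_injective W.subtype W.injective_subtype (congrArg Subtype.val h)
  rw [← h1, ← Set.ncard_range_of_injective hf]
  congr 1
  ext p
  constructor
  · intro hp
    rw [mem_pointsOf] at hp
    refine ⟨Projectivization.mk K ⟨p.1.rep, hp⟩ fun h =>
      p.1.rep_nonzero (congrArg Subtype.val h), Subtype.ext ?_⟩
    simp only [f, Projectivization.map_mk]
    exact p.1.mk_rep
  · rintro ⟨r, rfl⟩
    exact hmap r

/-- Every isotropic vector orthogonal to `x` and outside its span lies in exactly one isotropic
plane through `x`, and each such plane contains `q ^ 4 - q ^ 2` of them. -/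
theorem ncard_lines_through {σ : K →+* K} (hσ : ∀ x, σ x = x ^ q) (hK : Fintype.card K = q ^ 2)
    (hq : 2 ≤ q) (x : HermitianPoint q K) :
    {M | M ∈ hermitianLines q K ∧ x ∈ M}.ncard = q ^ 3 + 1 := by
  classical
  let T : Set (Submodule K (Fin 5 → K)) := {W | Module.finrank K W = 2 ∧
    (∀ v ∈ W, ∑ i, v i ^ (q + 1) = 0) ∧ x.1.rep ∈ W}
  have hT : {M | M ∈ hermitianLines q K ∧ x ∈ M} = pointsOf q '' T := by
    ext M
    constructor
    · rintro ⟨⟨W, h2, hW, rfl⟩, hx⟩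
      exact ⟨W, ⟨h2, hW, mem_pointsOf.1 hx⟩, rfl⟩
    · rintro ⟨W, ⟨h2, hW, hx⟩, rfl⟩
      exact ⟨⟨W, h2, hW, rfl⟩, mem_pointsOf.2 hx⟩
  have hinj : Set.InjOn (pointsOf q) T := fun W hW W' hW' h =>
    le_antisymm (le_of_pointsOf_subset hW.2.1 h.subset)
      (le_of_pointsOf_subset hW'.2.1 h.symm.subset)
  have hTf : T.Finite := Set.toFinite T
  rw [hT, hinj.ncard_image]
  have hx0 := x.1.rep_nonzero
  have key := ncard_isotropic_orthogonal hσ hK hq x.isotropic_rep hx0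
  set S := {v : Fin 5 → K | (∑ i, v i ^ (q + 1) = 0 ∧ hermitianDual σ x.1.rep v = 0) ∧
    v ∉ K ∙ x.1.rep} with hS
  have hspan : (K ∙ x.1.rep : Set (Fin 5 → K)).ncard = q ^ 2 := by
    have h1 := Module.natCard_eq_pow_finrank (K := K) (V := K ∙ x.1.rep)
    rw [finrank_span_singleton hx0, Nat.card_eq_fintype_card (α := K), hK, pow_one] at h1
    exact h1
  have hcount : S.ncard = T.ncard * (q ^ 4 - q ^ 2) := by
    rw [Set.ncard_eq_toFinset_card', Set.ncard_eq_toFinset_card T hTf,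
      Finset.card_eq_sum_card_fiberwise (f := fun v => (K ∙ x.1.rep) ⊔ K ∙ v) (t := hTf.toFinset)]
    · refine Finset.sum_const_nat fun W hW => ?_
      rw [Set.Finite.mem_toFinset] at hW
      obtain ⟨h2, hW, hxW⟩ := hW
      have hWc : (W : Set (Fin 5 → K)).ncard = q ^ 4 := by
        have h1 := Module.natCard_eq_pow_finrank (K := K) (V := W)
        rw [h2, Nat.card_eq_fintype_card (α := K), hK, ← pow_mul] at h1
        exact h1
      have hsub : (K ∙ x.1.rep : Set (Fin 5 → K)) ⊆ W := by
        rwa [SetLike.coe_subset_coe, Submodule.span_singleton_le_iff_mem]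
      rw [← hWc, ← hspan, ← Set.ncard_sdiff hsub, ← Set.ncard_coe_finset]
      congr 1
      ext v
      simp only [Finset.coe_filter, Set.mem_toFinset, Set.mem_ofPred_eq, Set.mem_sdiff,
        SetLike.mem_coe, hS]
      constructor
      · rintro ⟨⟨-, hv⟩, rfl⟩
        exact ⟨Submodule.mem_sup_right (Submodule.mem_span_singleton_self v), hv⟩
      · rintro ⟨hvW, hv⟩
        exact ⟨⟨⟨hW v hvW, hermitianDual_eq_zero hσ hK hq hW hxW hvW⟩, hv⟩,
          span_pair_eq hx0 hv h2 hxW hvW⟩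
    · intro v hv
      rw [Set.coe_toFinset] at hv
      obtain ⟨⟨hv0, hvx⟩, hv⟩ := hv
      rw [Set.Finite.coe_toFinset]
      refine ⟨finrank_span_pair hx0 hv, ?_,
        Submodule.mem_sup_left (Submodule.mem_span_singleton_self _)⟩
      change ∀ w ∈ (K ∙ x.1.rep) ⊔ K ∙ v, _
      rw [sup_comm]
      refine isotropic_sup_span hσ hK (isotropic_span_singleton hv0) x.isotropic_rep ?_
      intro w hw
      obtain ⟨a, rfl⟩ := Submodule.mem_span_singleton.1 hw
      rw [map_smul, hvx, smul_zero]
  have hlt : q ^ 2 < q ^ 4 := Nat.pow_lt_pow_right (by omega) (by norm_num)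
  have h3 : T.ncard * (q ^ 4 - q ^ 2) = (q ^ 3 + 1) * (q ^ 4 - q ^ 2) := by
    rw [← hcount, Nat.mul_sub, ← key, Nat.add_sub_cancel]
  exact Nat.eq_of_mul_eq_mul_right (by omega) h3

/-- The points of `W` collinear with `x` are those orthogonal to `x`. The form with `x` cannot
vanish on `W`, or `W` and `x` would span an isotropic space of dimension three in dimension five; so
its kernel on `W` is a single point. -/
theorem projection {σ : K →+* K} (hσ : ∀ x, σ x = x ^ q) (hK : Fintype.card K = q ^ 2)
    (hq : 2 ≤ q) (x : HermitianPoint q K) {W : Submodule K (Fin 5 → K)}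
    (hW2 : Module.finrank K W = 2) (hW : ∀ v ∈ W, ∑ i, v i ^ (q + 1) = 0)
    (hx : x ∉ pointsOf q W) :
    ∃! yM : HermitianPoint q K × Set (HermitianPoint q K), yM.2 ∈ hermitianLines q K ∧
      yM.1 ∈ yM.2 ∧ x ∈ yM.2 ∧ yM.1 ∈ pointsOf q W := by
  rw [mem_pointsOf] at hx
  set f : Module.Dual K W := (hermitianDual σ x.1.rep).comp W.subtype with hf
  have hf0 : f ≠ 0 := by
    intro h0
    have h1 := isotropic_sup_span hσ hK hW x.isotropic_rep fun v hv =>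
      LinearMap.congr_fun h0 ⟨v, hv⟩
    have h2 := two_mul_finrank_le hσ hK hq h1
    rw [Submodule.finrank_sup_span_singleton hx, hW2, Fintype.card_fin] at h2
    omega
  have hker := Module.Dual.finrank_ker_add_one_of_ne_zero hf0
  set Z := (LinearMap.ker f).map W.subtype with hZ
  have hZ1 : Module.finrank K Z = 1 := by
    rw [hZ, Submodule.finrank_map_subtype_eq]
    omega
  have hmem : ∀ v, v ∈ Z ↔ v ∈ W ∧ hermitianDual σ x.1.rep v = 0 := by
    intro v
    simp [hZ, hf, LinearMap.mem_ker, and_comm]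
  let y : HermitianPoint q K := ⟨Projectivization.mk'' Z hZ1, fun v hv => by
    rw [Projectivization.submodule_mk''] at hv
    exact hW v ((hmem v).1 hv).1⟩
  have hyZ : y.1.submodule = Z := Projectivization.submodule_mk'' Z hZ1
  have hy : y.1.rep ∈ Z := by
    rw [← Submodule.span_singleton_le_iff_mem, ← Projectivization.submodule_eq, hyZ]
  have hyW := ((hmem _).1 hy).1
  have hxy : x ≠ y := fun h => hx (h ▸ hyW)
  have hU2 := finrank_span_pair x.1.rep_nonzero (rep_notMem_span hxy)
  have hU : ∀ v ∈ (K ∙ x.1.rep) ⊔ K ∙ y.1.rep, ∑ i, v i ^ (q + 1) = 0 := by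
    rw [sup_comm]
    refine isotropic_sup_span hσ hK (isotropic_span_singleton y.isotropic_rep) x.isotropic_rep ?_
    intro w hw
    obtain ⟨a, rfl⟩ := Submodule.mem_span_singleton.1 hw
    rw [map_smul, ((hmem _).1 hy).2, smul_zero]
  have hxU : x ∈ pointsOf q ((K ∙ x.1.rep) ⊔ K ∙ y.1.rep) :=
    mem_pointsOf.2 (Submodule.mem_sup_left (Submodule.mem_span_singleton_self _))
  have hyU : y ∈ pointsOf q ((K ∙ x.1.rep) ⊔ K ∙ y.1.rep) :=
    mem_pointsOf.2 (Submodule.mem_sup_right (Submodule.mem_span_singleton_self _))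
  refine ⟨(y, pointsOf q ((K ∙ x.1.rep) ⊔ K ∙ y.1.rep)), ⟨⟨_, hU2, hU, rfl⟩, hyU, hxU,
    mem_pointsOf.2 hyW⟩, ?_⟩
  rintro ⟨y', M'⟩ ⟨⟨W', hW'2, hW', hM'⟩, hy', hx', hy'W⟩
  change M' = pointsOf q W' at hM'
  simp only at hy' hx' hy'W
  subst hM'
  rw [mem_pointsOf] at hy'W
  have hy'Z : y'.1.rep ∈ Z := (hmem _).2 ⟨hy'W,
    hermitianDual_eq_zero hσ hK hq hW' (mem_pointsOf.1 hx') (mem_pointsOf.1 hy')⟩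
  rw [← Submodule.span_singleton_le_iff_mem, ← Projectivization.submodule_eq, ← hyZ] at hy'Z
  obtain rfl : y' = y := Subtype.ext (Projectivization.submodule_injective
    (Submodule.eq_of_le_of_finrank_eq hy'Z (by simp [Projectivization.finrank_submodule])))
  rw [line_eq hxy hW'2 hU2 hx' hy' hxU hyU]

end HermitianPoint

/-! ### The quadrangle and the main theorem -/

theorem isGeneralizedQuadrangle_hermitianLines {q : ℕ} (hqp : IsPrimePow q) {K : Type*} [Field K]
    [Fintype K] (hK : Fintype.card K = q ^ 2) :
    IsGeneralizedQuadrangle (hermitianLines q K) (q ^ 2) (q ^ 3) := by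
  classical
  have hq : 2 ≤ q := hqp.two_le
  obtain ⟨σ, hσ⟩ := exists_frobenius hqp hK
  refine ⟨?_, Nat.one_le_pow _ _ (by omega), Nat.one_le_pow _ _ (by omega),
    HermitianPoint.ncard_lines_through hσ hK hq, ?_, ?_, ?_, ?_⟩
  · have h1 := card_isotropic_five hσ hK hq
    have h2 : q ^ 5 < q ^ 9 := Nat.pow_lt_pow_right (by omega) (by norm_num)
    have h3 : 1 ≤ q ^ 4 := Nat.one_le_pow _ _ (by omega)
    -- The count exceeds one, so some isotropic vector is nonzero.
    obtain ⟨v, hv, hv0⟩ := Finset.exists_mem_ne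
      (s := Finset.univ.filter fun v : Fin 5 → K => ∑ i, v i ^ (q + 1) = 0) (by omega) 0
    exact ⟨HermitianPoint.mk v hv0 (by simpa using hv)⟩
  · rintro x y hxy _ ⟨W, hW, -, rfl⟩ _ ⟨W', hW', -, rfl⟩ hx hy hx' hy'
    rw [HermitianPoint.line_eq hxy hW hW' hx hy hx' hy']
  · rintro _ ⟨W, hW2, hW, rfl⟩
    exact HermitianPoint.ncard_pointsOf hK hW2 hW
  · rintro _ ⟨W, hW, -, rfl⟩ _ ⟨W', hW', -, rfl⟩ hne x y hx hx' hy hy'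
    by_contra hxy
    exact hne (by rw [HermitianPoint.line_eq hxy hW hW' hx hy hx' hy'])
  · rintro x _ ⟨W, hW2, hW, rfl⟩ hx
    exact HermitianPoint.projection hσ hK hq x hW2 hW hx

theorem mainTheorem4 :
    -- the Hermitian variety in `PG(4, q ^ 2)` is a generalized quadrangle of order `(q ^ 2, q ^ 3)`
    (∀ q : ℕ, IsPrimePow q → ∀ (K : Type*) [Field K] [Fintype K], Fintype.card K = q ^ 2 →
      IsGeneralizedQuadrangle (hermitianLines q K) (q ^ 2) (q ^ 3)) ∧
    -- number of buckets `m = m k`, with `m k = (1 + o(1)) k ^ 4`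
    ∃ m : ℕ → ℕ, Tendsto (fun k : ℕ => (m k : ℝ) / (k : ℝ) ^ 4) atTop (𝓝 1) ∧
      ∀ q k : ℕ, IsPrimePow q → k = q ^ 2 → ∃ n₀ : ℕ, ∀ n ≥ n₀, ∀ g N : ℕ,
        g = ⌈(n : ℝ) / (k : ℝ) ^ 4⌉₊ → N = g * m k →
        -- the rate
        1 - 1 / Real.sqrt k ≤ (n : ℝ) / (N : ℝ) ∧
        -- `g` stacked copies of a systematic code on the incidence graph of any generalized
        -- quadrangle of order `(q ^ 2, q ^ 3)`, with lines as message symbols and points as parities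
        ∀ (P : Type*) [Fintype P] (𝓛 : Set (Set P)) [Fintype 𝓛],
          IsGeneralizedQuadrangle 𝓛 (q ^ 2) (q ^ 3) →
          ∀ (F : Type*) [Field F] [Finite F] (E : Matrix 𝓛 P F),
            (∀ (M : 𝓛) (p : P), E M p ≠ 0 ↔ p ∈ (M : Set P)) →
            ∀ e : 𝓛 ≃ Fin (Fintype.card 𝓛),
              IsMultisetBatchCode n N k (m k) 1 (stackedCode n g e (systematicCode E))
                (fun jv : Fin g × (𝓛 ⊕ P) => jv.2) := by

  refine ⟨fun q hq K _ _ hK => isGeneralizedQuadrangle_hermitianLines hq hK, bucketCount,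
    tendsto_bucketCount, ?_⟩
  rintro q k hq rfl
  obtain ⟨n₀, hn₀, hrate⟩ := exists_rate_bound hq.two_le
  refine ⟨n₀, fun n hn g N hg hN => ?_⟩
  have hpow : ((q ^ 2 : ℕ) : ℝ) ^ 4 = (q : ℝ) ^ 8 := by push_cast; ring
  have hq0 : (0 : ℝ) < q := by exact_mod_cast hq.pos
  rw [hpow] at hg
  refine ⟨?_, ?_⟩
  · have h1 := hrate n hn
    rw [← hg] at h1
    rwa [hN, Nat.cast_mul, Nat.cast_pow, Real.sqrt_sq hq0.le]
  · intro P _ 𝓛 _ h F _ _ E hE e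
    have hn0 : (0 : ℝ) < n := by exact_mod_cast hn₀.trans_le hn
    have hg0 : 0 < g := by rw [hg]; exact Nat.ceil_pos.2 (by positivity)
    -- Here `k = q ^ 2 = s`, one below what the greedy choice allows.
    refine h.isMultisetBatchCode (Nat.le_succ _) hE e hg0 ?_ ?_ hN
    · have h1 : (n : ℝ) / (q : ℝ) ^ 8 ≤ g := hg ▸ Nat.le_ceil _
      rw [div_le_iff₀ (by positivity)] at h1
      have h2 : n ≤ g * q ^ 8 := by exact_mod_cast h1
      -- A block has at least `q ^ 8 = k ^ 4` symbols, so `g` blocks cover the message.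
      refine h2.trans (Nat.mul_le_mul_left g ?_)
      rw [h.card_lines]
      calc q ^ 8 ≤ q ^ 8 + (q ^ 5 + q ^ 3 + 1) := Nat.le_add_right _ _
        _ = _ := by ring
    · rw [h.card_lines, h.card_points, bucketCount_sq]
      ring
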